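/- Let $H$ be a complex Hilbert space. For a bounded operator $T$ on $H$ let $s_n(T)=\inf\{\|T-R\|:\ R \text{ bounded on } H,\ \operatorname{rank}R\le n\}$, $n\ge 0$, be its singular values, and for $0<p<\infty$ let $\boldsymbol S_p$ be the Schatten–von Neumann class of bounded operators $T$ on $H$ with $\sum_{n\ge0}s_n(T)^p<\infty$. Let $0<p<\infty$ and $\alpha\in(\tfrac12,1]$. Suppose that $X$ and $Y$ are bounded self-adjoint operators on $H$ such that $0\le X\le I$, $0\le Y\le I$ and $\operatorname{Ker}X=\{0\}$, and let $X^{-\alpha}$ denote the (possibly unbounded) inverse of $X^{\alpha}$, defined on $\operatorname{Range}X^{\alpha}$. If $Y-X\in\boldsymbol S_p$ and the operator $(Y-X)X^{-\alpha}$, defined on $\operatorname{Range}X^{\alpha}$, extends to an operator on $H$ of class $\boldsymbol S_p$, then $Y^{1/2}-X^{1/2}\in\boldsymbol S_p$. -/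

import Mathlib

noncomputable section

/-- The `n`-th singular value `s_n(T) = inf {‖T - R‖ : rank R ≤ n}` (`n = 0, 1, 2, …`) of a bounded
operator `T` on a Hilbert space. The rank is a cardinal, so `R` really has finite rank. -/
def singularValue {H : Type*} [NormedAddCommGroup H] [InnerProductSpace ℂ H]
    (T : H →L[ℂ] H) (n : ℕ) : ℝ :=
  ⨅ R : {R : H →L[ℂ] H // (R : H →ₗ[ℂ] H).rank ≤ (n : Cardinal)}, ‖T - R.1‖

/-- The Schatten-von Neumann class `S_p`, `0 < p < ∞`: the bounded operators `T` with
`∑ s_n(T) ^ p < ∞`. Then `s_n(T) → 0`, so such a `T` is automatically compact. -/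
def schattenClass (H : Type*) [NormedAddCommGroup H] [InnerProductSpace ℂ H]
    (p : ℝ) : Set (H →L[ℂ] H) :=
  {T | Summable fun n : ℕ => singularValue T n ^ p}

/-- For a nonnegative injective bounded operator `X` and `a > 0`, the (in general unbounded)
operator `X ^ (-a)`: the inverse of the injective bounded operator `X ^ a`, with domain the range
of `X ^ a`. -/
def negPow {H : Type*} [NormedAddCommGroup H] [InnerProductSpace ℂ H] [CompleteSpace H]
    (X : H →L[ℂ] H) (a : ℝ) : H →ₗ.[ℂ] H :=
  (((X ^ a : H →L[ℂ] H) : H →ₗ[ℂ] H).toPMap ⊤).inverse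

/-- The partially defined operator `S` extends to an (everywhere defined, bounded) operator of
class `S_p`. Here `≤` between partially defined operators means extension. -/
def ExtendsToSchatten {H : Type*} [NormedAddCommGroup H] [InnerProductSpace ℂ H]
    (S : H →ₗ.[ℂ] H) (p : ℝ) : Prop :=
  ∃ K ∈ schattenClass H p, S ≤ (K : H →ₗ[ℂ] H).toPMap ⊤

end

/-!
Put `A = Y ^ (1/2)`, `B = X ^ (1/2)`, `D = A - B`. The hypothesis on `(Y - X) X ^ (-α)` says that
`Y - X = K X ^ α` with `K ∈ S_p`, so `D` solves the Sylvester equation `A D + D B = K B ^ β` with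
`β = 2 α > 1`. The claim is that any solution `D` is in `S_p`
(`mem_schattenClass_of_sylvester`).

For `p ≥ 1` one could integrate `e ^ (-t A) K B ^ β e ^ (-t B)` over `t > 0`; for `p < 1` a norm
bound on the integrand does not control the integral in `S_p`, and `D` is instead written as a
rapidly converging double series of terms `L K R`.
A partition of unity `ψ_j` on `(0, 1]`, with `ψ_j` living where `b` is within a factor `2` of
`t = 2 ^ (-j)`, splits `D` into the pieces `D ψ_j(B)`. With the Cayley transforms
`U = (A - t) / (A + t)` and `V = (B - t) / (B + t)`, the Sylvester equation gives
`E - U E V = 2 t (A + t)⁻¹ (A E + E B) (B + t)⁻¹`, and iterating this on `E = D ψ_j(B)` yields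
`D ψ_j(B) = ∑ₙ 2 t Uⁿ (A + t)⁻¹ K B ^ β ψ_j(B) (B + t)⁻¹ Vⁿ`. As `|V| ≤ 1 / 3` on the support of
`ψ_j`, the `(j, n)` term is `L K R` with `‖L‖ ‖R‖ ≤ C 2 ^ (-(β - 1) j) 3 ^ (-n)`. The pieces add up
to `D` because `B` is injective (`hasSum_leftFactor_mul_mul_rightFactor_prod`).

That such a series is in `S_p` for every `p > 0` follows without a triangle inequality in `S_p`
(`mem_schattenClass_of_hasSum`): if `‖L i‖ ‖R i‖ ≤ w i` and the `d i` are positive integers with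
`∑ 1 / d i ≤ Q`, approximating the `i`-th term up to rank `⌊m / d i⌋` gives
`s_{Q m}(T) ≤ ∑ w i s_{⌊m / d i⌋}(K)`, and the sum over `m` of `s_{⌊m / d i⌋}(K) ^ p` is
`d i` times that of `s_m(K) ^ p`. Geometric decay of `w` leaves room for `d` of polynomial growth.
-/

open scoped ENNReal NNReal

/-! ### Singular values and series of operators `L K R` -/

section SingularValues

variable {H : Type*} [NormedAddCommGroup H] [InnerProductSpace ℂ H]

lemma singularValue_le_norm_sub (T R : H →L[ℂ] H) {n : ℕ}
    (hR : (R : H →ₗ[ℂ] H).rank ≤ (n : Cardinal)) : singularValue T n ≤ ‖T - R‖ :=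
  ciInf_le (f := fun R : {R : H →L[ℂ] H // (R : H →ₗ[ℂ] H).rank ≤ (n : Cardinal)} => ‖T - R.1‖)
    ⟨0, by rintro _ ⟨R, rfl⟩; exact norm_nonneg _⟩ ⟨R, hR⟩

lemma rank_zero_le_natCast (n : ℕ) :
    (((0 : H →L[ℂ] H) : H →ₗ[ℂ] H)).rank ≤ (n : Cardinal) := by
  simp [LinearMap.rank_zero]

lemma exists_norm_sub_lt (T : H →L[ℂ] H) (n : ℕ) {ε : ℝ} (hε : 0 < ε) :
    ∃ R : H →L[ℂ] H, (R : H →ₗ[ℂ] H).rank ≤ (n : Cardinal) ∧ ‖T - R‖ < singularValue T n + ε := by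
  have : Nonempty {R : H →L[ℂ] H // (R : H →ₗ[ℂ] H).rank ≤ (n : Cardinal)} :=
    ⟨⟨0, rank_zero_le_natCast n⟩⟩
  obtain ⟨R, hR⟩ := exists_lt_of_ciInf_lt
    (f := fun R : {R : H →L[ℂ] H // (R : H →ₗ[ℂ] H).rank ≤ (n : Cardinal)} => ‖T - R.1‖)
    (show _ < singularValue T n + ε from lt_add_of_pos_right _ hε)
  exact ⟨R.1, R.2, hR⟩

lemma singularValue_nonneg (T : H →L[ℂ] H) (n : ℕ) : 0 ≤ singularValue T n :=
  Real.iInf_nonneg fun _ => norm_nonneg _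

lemma singularValue_le_norm (T : H →L[ℂ] H) (n : ℕ) : singularValue T n ≤ ‖T‖ := by
  simpa using singularValue_le_norm_sub T 0 (rank_zero_le_natCast n)

lemma singularValue_antitone (T : H →L[ℂ] H) : Antitone (singularValue T) := by
  intro m n hmn
  refine le_of_forall_pos_le_add fun ε hε => ?_
  obtain ⟨R, hR, hlt⟩ := exists_norm_sub_lt T m hε
  exact (singularValue_le_norm_sub T R (hR.trans (by exact_mod_cast hmn))).trans hlt.le

lemma singularValue_add_le (S T : H →L[ℂ] H) (m n : ℕ) :
    singularValue (S + T) (m + n) ≤ singularValue S m + singularValue T n := by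
  refine le_of_forall_pos_le_add fun ε hε => ?_
  obtain ⟨R, hR, hRlt⟩ := exists_norm_sub_lt S m (half_pos hε)
  obtain ⟨R', hR', hRlt'⟩ := exists_norm_sub_lt T n (half_pos hε)
  have hrank : ((R + R' : H →L[ℂ] H) : H →ₗ[ℂ] H).rank ≤ ((m + n : ℕ) : Cardinal) := by
    rw [ContinuousLinearMap.toLinearMap_add, Nat.cast_add]
    exact (LinearMap.rank_add_le _ _).trans (add_le_add hR hR')
  calc singularValue (S + T) (m + n) ≤ ‖S + T - (R + R')‖ := singularValue_le_norm_sub _ _ hrank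
    _ = ‖(S - R) + (T - R')‖ := by congr 1; abel
    _ ≤ ‖S - R‖ + ‖T - R'‖ := norm_add_le _ _
    _ ≤ singularValue S m + singularValue T n + ε := by linarith

lemma singularValue_mul_mul_le (L K R : H →L[ℂ] H) (n : ℕ) :
    singularValue (L * K * R) n ≤ ‖L‖ * ‖R‖ * singularValue K n := by
  refine le_of_forall_pos_le_add fun ε hε => ?_
  have hpos : 0 < ‖L‖ * ‖R‖ + 1 := by positivity
  obtain ⟨F, hF, hlt⟩ := exists_norm_sub_lt K n (div_pos hε hpos)
  have hrank : ((L * F * R : H →L[ℂ] H) : H →ₗ[ℂ] H).rank ≤ (n : Cardinal) := by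
    refine le_trans ?_ hF
    have h := (LinearMap.rank_comp_le_left (R : H →ₗ[ℂ] H) (((L * F : H →L[ℂ] H)) : H →ₗ[ℂ] H))
    exact h.trans (LinearMap.rank_comp_le_right (F : H →ₗ[ℂ] H) (L : H →ₗ[ℂ] H))
  calc singularValue (L * K * R) n ≤ ‖L * K * R - L * F * R‖ := singularValue_le_norm_sub _ _ hrank
    _ = ‖L * (K - F) * R‖ := by congr 1; noncomm_ring
    _ ≤ ‖L‖ * ‖K - F‖ * ‖R‖ :=
        (norm_mul_le _ _).trans (mul_le_mul_of_nonneg_right (norm_mul_le _ _) (norm_nonneg _))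
    _ = ‖L‖ * ‖R‖ * ‖K - F‖ := by ring
    _ ≤ ‖L‖ * ‖R‖ * (singularValue K n + ε / (‖L‖ * ‖R‖ + 1)) := by gcongr
    _ = ‖L‖ * ‖R‖ * singularValue K n + ‖L‖ * ‖R‖ / (‖L‖ * ‖R‖ + 1) * ε := by ring
    _ ≤ ‖L‖ * ‖R‖ * singularValue K n + 1 * ε := by
        gcongr
        rw [div_le_one hpos]
        linarith
    _ = _ := by rw [one_mul]

lemma singularValue_sum_le {ι : Type*} (T : ι → H →L[ℂ] H) (n : ι → ℕ) (F : Finset ι) :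
    singularValue (∑ i ∈ F, T i) (∑ i ∈ F, n i) ≤ ∑ i ∈ F, singularValue (T i) (n i) := by
  classical
  induction F using Finset.induction_on with
  | empty => simpa using singularValue_le_norm (0 : H →L[ℂ] H) 0
  | insert i F hi ih =>
    rw [Finset.sum_insert hi, Finset.sum_insert hi, Finset.sum_insert hi]
    exact (singularValue_add_le _ _ _ _).trans (by gcongr)

lemma mem_schattenClass_iff_tsum_ne_top {T : H →L[ℂ] H} {p : ℝ} (hp : 0 < p) :
    T ∈ schattenClass H p ↔ ∑' n, ENNReal.ofReal (singularValue T n) ^ p ≠ ∞ := by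
  have h : ∀ n, ENNReal.ofReal (singularValue T n) ^ p = ENNReal.ofReal (singularValue T n ^ p) :=
    fun n => ENNReal.ofReal_rpow_of_nonneg (singularValue_nonneg T n) hp.le
  simp only [h]
  refine ⟨fun hT => Summable.tsum_ofReal_ne_top hT, fun hT => ?_⟩
  refine (ENNReal.summable_toReal hT).congr fun n => ?_
  exact ENNReal.toReal_ofReal (Real.rpow_nonneg (singularValue_nonneg T n) p)

/-- Each value of `m / d` is taken exactly `d` times. -/
lemma ENNReal.tsum_comp_div (f : ℕ → ℝ≥0∞) (d : ℕ) (hd : d ≠ 0) :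
    ∑' m, f (m / d) = d * ∑' k, f k := by
  have : NeZero d := ⟨hd⟩
  rw [← (Nat.divModEquiv d).symm.tsum_eq, ENNReal.tsum_prod', ← ENNReal.tsum_mul_left]
  refine tsum_congr fun k => ?_
  have h : ∀ b : Fin d, f ((Nat.divModEquiv d).symm (k, b) / d) = f k := fun b => by
    rw [show (Nat.divModEquiv d).symm (k, b) / d = k from
      congrArg Prod.fst ((Nat.divModEquiv d).apply_symm_apply (k, b))]
  rw [tsum_congr h, tsum_fintype, Finset.sum_const, Finset.card_univ, Fintype.card_fin,
    nsmul_eq_mul]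

/-- If `T = ∑ L i K R i` and the ranks `n i` add up to at most `N`, then
`s_N(T) ≤ ∑ w i s_{n i}(K)`. Only finitely many `n i` are nonzero, so the tail of the series is
estimated by its norm. -/
lemma singularValue_hasSum_le {ι : Type*} {T K : H →L[ℂ] H} {L R : ι → H →L[ℂ] H} {w : ι → ℝ≥0}
    (hT : HasSum (fun i => L i * K * R i) T) (hw : ∀ i, ‖L i‖ * ‖R i‖ ≤ w i) {n : ι → ℕ} {N : ℕ}
    (hn : ∀ F : Finset ι, ∑ i ∈ F, n i ≤ N) :
    ENNReal.ofReal (singularValue T N) ≤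
      ∑' i, (w i : ℝ≥0∞) * ENNReal.ofReal (singularValue K (n i)) := by
  have hF : ∀ F : Finset ι, ENNReal.ofReal (singularValue T N) ≤
      (∑' i, (w i : ℝ≥0∞) * ENNReal.ofReal (singularValue K (n i))) +
        ENNReal.ofReal ‖T - ∑ i ∈ F, L i * K * R i‖ := by
    intro F
    set S := ∑ i ∈ F, L i * K * R i
    have h1 : singularValue T N ≤
        (∑ i ∈ F, w i * singularValue K (n i)) + ‖T - S‖ := by
      calc singularValue T N ≤ singularValue T (∑ i ∈ F, n i) := singularValue_antitone T (hn F)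
        _ = singularValue (S + (T - S)) (∑ i ∈ F, n i + 0) := by simp
        _ ≤ singularValue S (∑ i ∈ F, n i) + singularValue (T - S) 0 :=
            singularValue_add_le _ _ _ _
        _ ≤ (∑ i ∈ F, singularValue (L i * K * R i) (n i)) + ‖T - S‖ :=
            add_le_add (singularValue_sum_le _ _ _) (singularValue_le_norm _ _)
        _ ≤ _ := by
            gcongr with i
            exact (singularValue_mul_mul_le _ _ _ _).trans
              (mul_le_mul_of_nonneg_right (hw i) (singularValue_nonneg _ _))
    have hnn : ∀ i, 0 ≤ (w i : ℝ) * singularValue K (n i) := fun i =>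
      mul_nonneg (w i).2 (singularValue_nonneg _ _)
    calc _ ≤ ENNReal.ofReal ((∑ i ∈ F, w i * singularValue K (n i)) + ‖T - S‖) :=
          ENNReal.ofReal_le_ofReal h1
      _ = (∑ i ∈ F, (w i : ℝ≥0∞) * ENNReal.ofReal (singularValue K (n i))) +
            ENNReal.ofReal ‖T - S‖ := by
          rw [ENNReal.ofReal_add (Finset.sum_nonneg fun i _ => hnn i) (norm_nonneg _),
            ENNReal.ofReal_sum_of_nonneg fun i _ => hnn i]
          congr 1
          refine Finset.sum_congr rfl fun i _ => ?_
          rw [ENNReal.ofReal_mul (w i).coe_nonneg, ENNReal.ofReal_coe_nnreal]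
      _ ≤ _ := by
          gcongr
          exact ENNReal.sum_le_tsum F
  have hlim : Filter.Tendsto (fun F : Finset ι => ENNReal.ofReal ‖T - ∑ i ∈ F, L i * K * R i‖)
      Filter.atTop (nhds 0) := by
    have h : Filter.Tendsto (fun F : Finset ι => T - ∑ i ∈ F, L i * K * R i)
        Filter.atTop (nhds (T - T)) := Filter.Tendsto.sub tendsto_const_nhds hT
    simpa using ENNReal.tendsto_ofReal h.norm
  refine ge_of_tendsto' (x := Filter.atTop) (f := fun F : Finset ι =>
      (∑' i, (w i : ℝ≥0∞) * ENNReal.ofReal (singularValue K (n i))) +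
        ENNReal.ofReal ‖T - ∑ i ∈ F, L i * K * R i‖) ?_ hF
  simpa using hlim.const_add (∑' i, (w i : ℝ≥0∞) * ENNReal.ofReal (singularValue K (n i)))

/-- A substitute for Hölder's inequality that covers all `p > 0` at once, at the price of
splitting `w i` into two square roots: each `√(w i) x i` is at most the `ℓ^p` norm of the family. -/
lemma ENNReal.rpow_tsum_mul_le {ι : Type*} (w x : ι → ℝ≥0∞) {p : ℝ} (hp : 0 < p) :
    (∑' i, w i * x i) ^ p ≤
      (∑' i, w i ^ (1 / 2 : ℝ)) ^ p * ∑' i, w i ^ (p / 2) * x i ^ p := by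
  set G := ∑' i, w i ^ (p / 2) * x i ^ p
  have hx : ∀ i, w i * x i ≤ w i ^ (1 / 2 : ℝ) * G ^ (1 / p) := by
    intro i
    have h1 : w i = w i ^ (1 / 2 : ℝ) * w i ^ (1 / 2 : ℝ) := by
      rw [← ENNReal.rpow_add_of_nonneg _ _ (by norm_num) (by norm_num)]
      norm_num
    have h2 : w i ^ (1 / 2 : ℝ) * x i = (w i ^ (p / 2) * x i ^ p) ^ (1 / p) := by
      rw [ENNReal.mul_rpow_of_nonneg _ _ (by positivity), ← ENNReal.rpow_mul, ← ENNReal.rpow_mul,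
        mul_one_div_cancel hp.ne', ENNReal.rpow_one]
      congr 2
      field_simp
    calc w i * x i = w i ^ (1 / 2 : ℝ) * (w i ^ (1 / 2 : ℝ) * x i) := by
          rw [← mul_assoc, ← h1]
      _ ≤ _ := by
          rw [h2]
          gcongr
          exact ENNReal.le_tsum i
  calc (∑' i, w i * x i) ^ p ≤ (∑' i, w i ^ (1 / 2 : ℝ) * G ^ (1 / p)) ^ p := by
        exact ENNReal.rpow_le_rpow (ENNReal.tsum_le_tsum hx) hp.le
    _ = (∑' i, w i ^ (1 / 2 : ℝ)) ^ p * G := by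
        rw [ENNReal.tsum_mul_right, ENNReal.mul_rpow_of_nonneg _ _ hp.le, ← ENNReal.rpow_mul,
          one_div_mul_cancel hp.ne', ENNReal.rpow_one]

/-- Membership of a series `∑ L i K R i` in `S_p`. The integer `d i` says that the `i`-th term is
allotted the share `1 / d i` of the total rank. -/
theorem mem_schattenClass_of_hasSum {ι : Type*} {T K : H →L[ℂ] H} {L R : ι → H →L[ℂ] H}
    {w : ι → ℝ≥0} {d : ι → ℕ} {p : ℝ} (hp : 0 < p) (hK : K ∈ schattenClass H p)
    (hT : HasSum (fun i => L i * K * R i) T) (hw : ∀ i, ‖L i‖ * ‖R i‖ ≤ w i)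
    (hd0 : ∀ i, d i ≠ 0) (hd : Summable fun i => (1 / d i : ℝ))
    (hw1 : Summable fun i => w i ^ (1 / 2 : ℝ))
    (hw2 : Summable fun i => (d i : ℝ≥0) * w i ^ (p / 2)) : T ∈ schattenClass H p := by
  rw [mem_schattenClass_iff_tsum_ne_top hp] at hK ⊢
  -- The maximum with `1` only ensures `Q ≠ 0`.
  obtain ⟨Q, hQ⟩ := exists_nat_ge (max 1 (∑' i, (1 / d i : ℝ)))
  have hQ0 : Q ≠ 0 := by
    rintro rfl
    exact absurd ((le_max_left _ _).trans hQ) (by norm_num)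
  set W : ℝ≥0∞ := (∑' i, (w i : ℝ≥0∞) ^ (1 / 2 : ℝ)) ^ p
  have hW : W ≠ ∞ := by
    refine ENNReal.rpow_ne_top_of_nonneg hp.le ?_
    simp_rw [← ENNReal.coe_rpow_of_nonneg _ (show (0 : ℝ) ≤ 1 / 2 by norm_num)]
    exact ENNReal.tsum_coe_ne_top_iff_summable.2 hw1
  have hsum : ∑' i, (d i : ℝ≥0∞) * (w i : ℝ≥0∞) ^ (p / 2) ≠ ∞ := by
    have h : ∀ i, (d i : ℝ≥0∞) * (w i : ℝ≥0∞) ^ (p / 2) =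
        (((d i : ℝ≥0) * w i ^ (p / 2) : ℝ≥0) : ℝ≥0∞) := fun i => by
      rw [← ENNReal.coe_rpow_of_nonneg _ (by positivity)]
      push_cast
      rfl
    simp_rw [h]
    exact ENNReal.tsum_coe_ne_top_iff_summable.2 hw2
  have hkey : ∀ m, ENNReal.ofReal (singularValue T (Q * m)) ^ p ≤
      W * ∑' i, (w i : ℝ≥0∞) ^ (p / 2) * ENNReal.ofReal (singularValue K (m / d i)) ^ p := by
    intro m
    refine le_trans ?_ (ENNReal.rpow_tsum_mul_le _ _ hp)
    refine ENNReal.rpow_le_rpow (singularValue_hasSum_le hT hw fun F => ?_) hp.le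
    have h : (((∑ i ∈ F, m / d i : ℕ)) : ℝ) ≤ ((Q * m : ℕ) : ℝ) := by
      push_cast
      calc ∑ i ∈ F, ((m / d i : ℕ) : ℝ) ≤ ∑ i ∈ F, (1 / d i : ℝ) * m := by
            gcongr with i
            rw [one_div_mul_eq_div]
            exact Nat.cast_div_le
        _ = (∑ i ∈ F, (1 / d i : ℝ)) * m := by rw [Finset.sum_mul]
        _ ≤ Q * m := by
            gcongr
            exact (hd.sum_le_tsum F fun i _ => by positivity).trans ((le_max_right _ _).trans hQ)
    exact_mod_cast h
  have hfin : ∑' m, ENNReal.ofReal (singularValue T (Q * m)) ^ p ≠ ∞ := by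
    refine ne_top_of_le_ne_top ?_ (ENNReal.tsum_le_tsum hkey)
    rw [ENNReal.tsum_mul_left, ENNReal.tsum_comm]
    refine ENNReal.mul_ne_top hW ?_
    have h : ∀ i, ∑' m, (w i : ℝ≥0∞) ^ (p / 2) * ENNReal.ofReal (singularValue K (m / d i)) ^ p =
        (d i : ℝ≥0∞) * (w i : ℝ≥0∞) ^ (p / 2) * ∑' k, ENNReal.ofReal (singularValue K k) ^ p := by
      intro i
      rw [ENNReal.tsum_mul_left,
        ENNReal.tsum_comp_div (fun k => ENNReal.ofReal (singularValue K k) ^ p) _ (hd0 i)]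
      ring
    simp_rw [h]
    rw [ENNReal.tsum_mul_right]
    exact ENNReal.mul_ne_top hsum hK
  refine ne_top_of_le_ne_top (ENNReal.mul_ne_top (ENNReal.natCast_ne_top Q) hfin) ?_
  rw [← ENNReal.tsum_comp_div (fun m => ENNReal.ofReal (singularValue T (Q * m)) ^ p) Q hQ0]
  refine ENNReal.tsum_le_tsum fun n => ?_
  gcongr
  exact singularValue_antitone T (Nat.mul_div_le n Q)

end SingularValues

/-! ### Geometric double series -/

lemma summable_succ_sq_mul_geometric {r : ℝ} (hr0 : 0 ≤ r) (hr : r < 1) :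
    Summable fun n : ℕ => ((n : ℝ) + 1) ^ 2 * r ^ n := by
  have hr' : ‖r‖ < 1 := by rwa [Real.norm_of_nonneg hr0]
  have h2 := summable_pow_mul_geometric_of_norm_lt_one 2 hr'
  have h1 := (summable_pow_mul_geometric_of_norm_lt_one 1 hr').mul_left 2
  have h0 := summable_pow_mul_geometric_of_norm_lt_one 0 hr'
  refine ((h2.add h1).add h0).congr fun n => ?_
  ring

lemma summable_one_div_succ_sq : Summable fun n : ℕ => (1 / ((n : ℝ) + 1) ^ 2) := by
  have h := (summable_nat_add_iff 1).2 (Real.summable_one_div_nat_pow.2 one_lt_two)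
  exact h.congr fun n => by push_cast; rfl

/-- The case of geometrically decaying double series, with rank shares
`1 / ((j + 1) ^ 2 (n + 1) ^ 2)`. -/
theorem mem_schattenClass_of_hasSum_prod {H : Type*} [NormedAddCommGroup H]
    [InnerProductSpace ℂ H] {T K : H →L[ℂ] H} {L R : ℕ × ℕ → H →L[ℂ] H}
    {C a b : ℝ≥0} (ha : a < 1) (hb : b < 1) {p : ℝ} (hp : 0 < p) (hK : K ∈ schattenClass H p)
    (hT : HasSum (fun i => L i * K * R i) T)
    (hw : ∀ i, ‖L i‖ * ‖R i‖ ≤ C * (a ^ i.1 * b ^ i.2)) : T ∈ schattenClass H p := by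
  have hpow : ∀ (c : ℝ≥0) (s : ℝ) (n : ℕ), (c ^ n) ^ s = (c ^ s) ^ n := fun c s n => by
    rw [← NNReal.rpow_natCast, ← NNReal.rpow_natCast, ← NNReal.rpow_mul, ← NNReal.rpow_mul,
      mul_comm]
  have hlt : ∀ (c : ℝ≥0) (s : ℝ), c < 1 → 0 < s → ((c ^ s : ℝ≥0) : ℝ) < 1 := fun c s hc hs => by
    exact_mod_cast NNReal.rpow_lt_one hc hs
  refine mem_schattenClass_of_hasSum (w := fun i => C * (a ^ i.1 * b ^ i.2))
    (d := fun i => (i.1 + 1) ^ 2 * (i.2 + 1) ^ 2) hp hK hT (fun i => by exact_mod_cast hw i)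
    (fun i => by positivity) ?_ ?_ ?_
  · refine (summable_one_div_succ_sq.mul_of_nonneg summable_one_div_succ_sq
      (fun n => by positivity) (fun n => by positivity)).congr fun i => ?_
    push_cast
    rw [one_div_mul_one_div]
  · rw [← NNReal.summable_coe]
    have h := ((summable_geometric_of_lt_one (NNReal.coe_nonneg _)
      (hlt a (1 / 2) ha (by norm_num))).mul_of_nonneg
      (summable_geometric_of_lt_one (NNReal.coe_nonneg _) (hlt b (1 / 2) hb (by norm_num)))
      (fun n => by positivity) (fun n => by positivity)).mul_left ((C ^ (1 / 2 : ℝ) : ℝ≥0) : ℝ)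
    refine h.congr fun i => ?_
    rw [NNReal.mul_rpow, NNReal.mul_rpow, hpow, hpow]
    simp only [NNReal.coe_mul, NNReal.coe_pow]
  · rw [← NNReal.summable_coe]
    have h := ((summable_succ_sq_mul_geometric (NNReal.coe_nonneg _)
      (hlt a (p / 2) ha (by positivity))).mul_of_nonneg
      (summable_succ_sq_mul_geometric (NNReal.coe_nonneg _) (hlt b (p / 2) hb (by positivity)))
      (fun n => by positivity) (fun n => by positivity)).mul_left ((C ^ (p / 2 : ℝ) : ℝ≥0) : ℝ)
    refine h.congr fun i => ?_
    rw [NNReal.mul_rpow, NNReal.mul_rpow, hpow, hpow]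
    push_cast
    ring

/-! ### A dyadic partition of unity -/

/-- The piecewise linear cutoff equal to `1` on `(-∞, 1]` and to `0` on `[2, ∞)`. -/
noncomputable def dyadicCutoff (x : ℝ) : ℝ := max 0 (min 1 (2 - x))

lemma continuous_dyadicCutoff : Continuous dyadicCutoff := by
  unfold dyadicCutoff; fun_prop

lemma dyadicCutoff_of_le_one {x : ℝ} (hx : x ≤ 1) : dyadicCutoff x = 1 := by
  rw [dyadicCutoff, min_eq_left (by linarith), max_eq_right zero_le_one]

lemma dyadicCutoff_of_two_le {x : ℝ} (hx : 2 ≤ x) : dyadicCutoff x = 0 := by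
  rw [dyadicCutoff, max_eq_left (min_le_of_right_le (by linarith))]

lemma dyadicCutoff_nonneg (x : ℝ) : 0 ≤ dyadicCutoff x := le_max_left _ _

lemma dyadicCutoff_le_one (x : ℝ) : dyadicCutoff x ≤ 1 :=
  max_le zero_le_one (min_le_left _ _)

/-- The bump at scale `t`: it vanishes outside `[t / 2, 2 t]`. The bumps at the scales
`2 ^ (-j)`, `j ≥ 0`, form a partition of unity on `(0, 1]`. -/
noncomputable def dyadicBump (t b : ℝ) : ℝ := dyadicCutoff (b / t) - dyadicCutoff (2 * b / t)

lemma continuous_dyadicBump (t : ℝ) : Continuous (dyadicBump t) := by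
  unfold dyadicBump
  have := continuous_dyadicCutoff
  fun_prop

lemma abs_dyadicBump_le_one (t b : ℝ) : |dyadicBump t b| ≤ 1 := by
  rw [dyadicBump, abs_le]
  constructor <;> linarith [dyadicCutoff_nonneg (b / t), dyadicCutoff_nonneg (2 * b / t),
    dyadicCutoff_le_one (b / t), dyadicCutoff_le_one (2 * b / t)]

lemma dyadicBump_eq_zero_or {t b : ℝ} (ht : 0 < t) :
    dyadicBump t b = 0 ∨ t ≤ 2 * b ∧ b ≤ 2 * t := by
  by_cases h1 : t ≤ 2 * b
  · by_cases h2 : b ≤ 2 * t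
    · exact .inr ⟨h1, h2⟩
    · left
      rw [dyadicBump, dyadicCutoff_of_two_le, dyadicCutoff_of_two_le, sub_self] <;>
        rw [le_div_iff₀ ht] <;> linarith
  · left
    rw [dyadicBump, dyadicCutoff_of_le_one, dyadicCutoff_of_le_one, sub_self] <;>
      rw [div_le_one ht] <;> linarith

/-- The sum telescopes, since `2 * b / 2 ^ (-j) = b / 2 ^ (-(j + 1))`. -/
lemma sum_dyadicBump (J : ℕ) {b : ℝ} (hb : b ≤ 1) :
    ∑ j ∈ Finset.range J, dyadicBump ((1 / 2) ^ j) b = 1 - dyadicCutoff (b / (1 / 2) ^ J) := by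
  have h : ∀ j : ℕ, dyadicBump ((1 / 2) ^ j) b =
      dyadicCutoff (b / (1 / 2) ^ j) - dyadicCutoff (b / (1 / 2) ^ (j + 1)) := fun j => by
    rw [dyadicBump]
    congr 2
    field_simp
    ring
  simp_rw [h]
  rw [Finset.sum_range_sub' fun j : ℕ => dyadicCutoff (b / (1 / 2) ^ j)]
  rw [pow_zero, div_one, dyadicCutoff_of_le_one hb]

lemma abs_cayley_le_one {t a : ℝ} (ht : 0 < t) (ha : 0 ≤ a) : |(a - t) / (a + t)| ≤ 1 := by
  rw [abs_div, abs_of_pos (by linarith : 0 < a + t), div_le_one (by linarith), abs_le]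
  constructor <;> linarith

lemma abs_cayley_le_third {t b : ℝ} (ht : 0 < t) (h1 : t ≤ 2 * b) (h2 : b ≤ 2 * t) :
    |(b - t) / (b + t)| ≤ 1 / 3 := by
  rw [abs_div, abs_of_pos (by linarith : 0 < b + t), div_le_iff₀ (by linarith), abs_le]
  constructor <;> linarith

/-! ### The Sylvester equation `A D + D B = K B ^ β` -/

section Sylvester

variable {H : Type*} [NormedAddCommGroup H] [InnerProductSpace ℂ H] [CompleteSpace H]

/-- The operator `t Uⁿ (A + t)⁻¹`, where `U = (A - t) (A + t)⁻¹` is the Cayley transform of `A`. -/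
noncomputable def leftFactor (A : H →L[ℂ] H) (t : ℝ) (n : ℕ) : H →L[ℂ] H :=
  cfc (fun a : ℝ => t * (((a - t) / (a + t)) ^ n / (a + t))) A

/-- The operator `2 B ^ β ψ(B) (B + t)⁻¹ Vⁿ`, where `V = (B - t) (B + t)⁻¹` is the Cayley transform
of `B` and `ψ` is the dyadic bump at scale `t`. -/
noncomputable def rightFactor (B : H →L[ℂ] H) (β t : ℝ) (n : ℕ) : H →L[ℂ] H :=
  cfc (fun b : ℝ => 2 * (b ^ β * (dyadicBump t b * ((b - t) / (b + t)) ^ n / (b + t)))) B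

lemma continuousOn_cayley_pow {s : Set ℝ} {t : ℝ} (ht : 0 < t) (hs : ∀ x ∈ s, 0 ≤ x) (n : ℕ) :
    ContinuousOn (fun a : ℝ => ((a - t) / (a + t)) ^ n) s := by
  have h0 : ∀ x ∈ s, x + t ≠ 0 := fun x hx => by linarith [hs x hx]
  fun_prop (disch := assumption)

lemma norm_leftFactor_le {A : H →L[ℂ] H} (hA : 0 ≤ A) {t : ℝ} (ht : 0 < t) (n : ℕ) :
    ‖leftFactor A t n‖ ≤ 1 := by
  refine norm_cfc_le zero_le_one fun a ha => ?_
  have ha0 : 0 ≤ a := spectrum_nonneg_of_nonneg hA ha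
  have h1 : |t / (a + t)| ≤ 1 := by
    rw [abs_of_nonneg (by positivity), div_le_one (by positivity)]
    linarith
  calc ‖t * (((a - t) / (a + t)) ^ n / (a + t))‖
      = |t / (a + t)| * |(a - t) / (a + t)| ^ n := by
        rw [Real.norm_eq_abs, ← abs_pow, ← abs_mul]
        congr 1
        ring
    _ ≤ 1 := mul_le_one₀ h1 (by positivity) (pow_le_one₀ (abs_nonneg _) (abs_cayley_le_one ht ha0))

/-- On the support of the bump, `b ^ β / (b + t) ≤ b ^ (β - 1) ≤ (2 t) ^ (β - 1)`, while the Cayley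
transform contributes a factor `1 / 3` for each power. -/
lemma norm_rightFactor_le {B : H →L[ℂ] H} (hB : 0 ≤ B) {β t : ℝ} (hβ : 1 < β) (ht : 0 < t)
    (n : ℕ) : ‖rightFactor B β t n‖ ≤ 2 * (2 * t) ^ (β - 1) * (1 / 3) ^ n := by
  refine norm_cfc_le (by positivity) fun b hb => ?_
  have hb0 : 0 ≤ b := spectrum_nonneg_of_nonneg hB hb
  rcases dyadicBump_eq_zero_or (b := b) ht with h | ⟨h1, h2⟩
  · simp only [h, zero_mul, zero_div, mul_zero, norm_zero]
    positivity
  have hbpos : 0 < b := by linarith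
  have hpow : b ^ β / (b + t) ≤ (2 * t) ^ (β - 1) := by
    calc b ^ β / (b + t) ≤ b ^ β / b := by gcongr; linarith
      _ = b ^ (β - 1) := by rw [Real.rpow_sub_one hbpos.ne']
      _ ≤ _ := Real.rpow_le_rpow hb0 h2 (by linarith)
  calc ‖2 * (b ^ β * (dyadicBump t b * ((b - t) / (b + t)) ^ n / (b + t)))‖
      = 2 * (b ^ β / (b + t)) * |(b - t) / (b + t)| ^ n * |dyadicBump t b| := by
        have hnn : 0 ≤ 2 * (b ^ β / (b + t)) := by positivity
        rw [Real.norm_eq_abs, ← abs_pow]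
        nth_rewrite 1 [← abs_of_nonneg hnn]
        rw [← abs_mul, ← abs_mul]
        congr 1
        ring
    _ ≤ 2 * (2 * t) ^ (β - 1) * (1 / 3) ^ n * 1 := by
        gcongr
        · exact abs_cayley_le_third ht h1 h2
        · exact abs_dyadicBump_le_one t b
    _ = _ := mul_one _

/-- The terms of the series are the differences of consecutive `Uⁿ D ψ(B) Vⁿ`, because of the
identity `(A + t) D (B + t) - (A - t) D (B - t) = 2 t (A D + D B)`. -/
lemma leftFactor_mul_mul_rightFactor {A B D K : H →L[ℂ] H} (hA : 0 ≤ A) (hB : 0 ≤ B) {β t : ℝ}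
    (hβ : 0 < β) (ht : 0 < t) (hD : A * D + D * B = K * B ^ β) (n : ℕ) :
    leftFactor A t n * K * rightFactor B β t n =
      cfc (fun a : ℝ => ((a - t) / (a + t)) ^ n) A * D *
          cfc (fun b : ℝ => dyadicBump t b * ((b - t) / (b + t)) ^ n) B -
        cfc (fun a : ℝ => ((a - t) / (a + t)) ^ (n + 1)) A * D *
          cfc (fun b : ℝ => dyadicBump t b * ((b - t) / (b + t)) ^ (n + 1)) B := by
  have hAs : ∀ x ∈ spectrum ℝ A, 0 ≤ x := fun x hx => spectrum_nonneg_of_nonneg hA hx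
  have hBs : ∀ x ∈ spectrum ℝ B, 0 ≤ x := fun x hx => spectrum_nonneg_of_nonneg hB hx
  have hA0 : ∀ x ∈ spectrum ℝ A, x + t ≠ 0 := fun x hx => by linarith [hAs x hx]
  have hB0 : ∀ x ∈ spectrum ℝ B, x + t ≠ 0 := fun x hx => by linarith [hBs x hx]
  have hAsa : IsSelfAdjoint A := .of_nonneg hA
  have hBsa : IsSelfAdjoint B := .of_nonneg hB
  have hbump := continuous_dyadicBump t
  have hUc := continuousOn_cayley_pow ht hAs n
  have hVc := continuousOn_cayley_pow ht hBs n
  have hPc : ContinuousOn (fun a : ℝ => ((a - t) / (a + t)) ^ n / (a + t)) (spectrum ℝ A) :=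
    hUc.div (by fun_prop) hA0
  have hQc : ContinuousOn (fun b : ℝ => dyadicBump t b * ((b - t) / (b + t)) ^ n / (b + t))
      (spectrum ℝ B) := (hbump.continuousOn.mul hVc).div (by fun_prop) hB0
  set P := cfc (fun a : ℝ => ((a - t) / (a + t)) ^ n / (a + t)) A with hP
  set Q := cfc (fun b : ℝ => dyadicBump t b * ((b - t) / (b + t)) ^ n / (b + t)) B with hQ
  have hidA : ∀ s : ℝ, cfc (fun a : ℝ => a + s) A = A + algebraMap ℝ _ s := fun s => by
    rw [cfc_add_const s (fun a => a) A, cfc_id' ℝ A]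
  have hidB : ∀ s : ℝ, cfc (fun a : ℝ => a + s) B = B + algebraMap ℝ _ s := fun s => by
    rw [cfc_add_const s (fun a => a) B, cfc_id' ℝ B]
  have hU : cfc (fun a : ℝ => ((a - t) / (a + t)) ^ n) A = P * (A + algebraMap ℝ _ t) := by
    rw [hP, ← hidA, ← cfc_mul _ _ A]
    exact cfc_congr fun a ha => (div_mul_cancel₀ _ (hA0 a ha)).symm
  have hU' : cfc (fun a : ℝ => ((a - t) / (a + t)) ^ (n + 1)) A =
      P * (A + algebraMap ℝ _ (-t)) := by
    rw [hP, ← hidA, ← cfc_mul _ _ A]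
    refine cfc_congr fun a ha => ?_
    simp only [pow_succ]
    ring
  have hV : cfc (fun b : ℝ => dyadicBump t b * ((b - t) / (b + t)) ^ n) B =
      (B + algebraMap ℝ _ t) * Q := by
    rw [hQ, ← hidB, ← cfc_mul _ _ B]
    exact cfc_congr fun b hb => (mul_div_cancel₀ _ (hB0 b hb)).symm
  have hV' : cfc (fun b : ℝ => dyadicBump t b * ((b - t) / (b + t)) ^ (n + 1)) B =
      (B + algebraMap ℝ _ (-t)) * Q := by
    rw [hQ, ← hidB, ← cfc_mul _ _ B]
    refine cfc_congr fun b hb => ?_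
    simp only [pow_succ]
    ring
  have hL : leftFactor A t n = t • P := by
    rw [leftFactor, hP, cfc_const_mul t _ A hPc]
  have hR : rightFactor B β t n = (2 : ℝ) • (B ^ β * Q) := by
    have hpowc : ContinuousOn (fun b : ℝ => b ^ β) (spectrum ℝ B) :=
      (Real.continuous_rpow_const hβ.le).continuousOn
    rw [rightFactor, cfc_const_mul 2 (fun b : ℝ => b ^ β *
      (dyadicBump t b * ((b - t) / (b + t)) ^ n / (b + t))) B (hpowc.mul hQc), cfc_mul _ _ B hpowc hQc,
      CFC.rpow_eq_cfc_real hB]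
  rw [hL, hR, hU, hU', hV, hV']
  calc t • P * K * ((2 : ℝ) • (B ^ β * Q)) = (2 * t) • (P * (K * B ^ β) * Q) := by
        simp only [smul_mul_assoc, mul_smul_comm, smul_smul, mul_assoc]
    _ = (2 * t) • (P * (A * D + D * B) * Q) := by rw [hD]
    _ = _ := by
        simp only [Algebra.algebraMap_eq_smul_one, neg_smul, mul_add, add_mul, mul_smul_comm,
          smul_mul_assoc, mul_one, one_mul, mul_neg, neg_mul, mul_assoc, two_mul, add_smul,
          smul_add, smul_smul, smul_neg]
        abel

lemma norm_leftFactor_mul_norm_rightFactor_le {A B : H →L[ℂ] H} (hA : 0 ≤ A) (hB : 0 ≤ B) {β : ℝ}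
    (hβ : 1 < β) (j n : ℕ) :
    ‖leftFactor A ((1 / 2) ^ j) n‖ * ‖rightFactor B β ((1 / 2) ^ j) n‖ ≤
      2 ^ β * (((1 / 2) ^ (β - 1)) ^ j * (1 / 3) ^ n) := by
  have ht : (0 : ℝ) < (1 / 2) ^ j := by positivity
  have h2 : (2 : ℝ) * (2 * (1 / 2) ^ j) ^ (β - 1) = 2 ^ β * ((1 / 2) ^ (β - 1)) ^ j := by
    rw [Real.mul_rpow two_pos.le ht.le, ← Real.rpow_natCast ((1 / 2 : ℝ) ^ (β - 1)) j,
      ← Real.rpow_natCast (1 / 2 : ℝ) j, ← Real.rpow_mul (by norm_num), ← Real.rpow_mul (by norm_num),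
      mul_comm (j : ℝ), ← mul_assoc, Real.rpow_sub_one two_ne_zero,
      mul_div_cancel₀ _ (two_ne_zero : (2 : ℝ) ≠ 0)]
  calc _ ≤ 1 * (2 * (2 * (1 / 2) ^ j) ^ (β - 1) * (1 / 3) ^ n) :=
        mul_le_mul (norm_leftFactor_le hA ht n) (norm_rightFactor_le hB hβ ht n)
          (norm_nonneg _) zero_le_one
    _ = _ := by rw [one_mul, h2, mul_assoc]

lemma hasSum_leftFactor_mul_mul_rightFactor {A B D K : H →L[ℂ] H} (hA : 0 ≤ A) (hB : 0 ≤ B)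
    {β t : ℝ} (hβ : 1 < β) (ht : 0 < t) (hD : A * D + D * B = K * B ^ β) :
    HasSum (fun n => leftFactor A t n * K * rightFactor B β t n) (D * cfc (dyadicBump t) B) := by
  have hBsa : IsSelfAdjoint B := .of_nonneg hB
  have hAsa : IsSelfAdjoint A := .of_nonneg hA
  have hsum : Summable fun n => leftFactor A t n * K * rightFactor B β t n := by
    refine Summable.of_norm_bounded (g := fun n : ℕ => ‖K‖ * (2 * (2 * t) ^ (β - 1)) * (1 / 3) ^ n)
      ((summable_geometric_of_lt_one (by norm_num) (by norm_num)).mul_left _) fun n => ?_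
    calc _ ≤ ‖leftFactor A t n‖ * ‖K‖ * ‖rightFactor B β t n‖ :=
          (norm_mul_le _ _).trans (mul_le_mul_of_nonneg_right (norm_mul_le _ _) (norm_nonneg _))
      _ ≤ 1 * ‖K‖ * (2 * (2 * t) ^ (β - 1) * (1 / 3) ^ n) := by
          gcongr
          · exact norm_leftFactor_le hA ht n
          · exact norm_rightFactor_le hB hβ ht n
      _ = _ := by ring
  refine hsum.hasSum_iff_tendsto_nat.2 ?_
  set G : ℕ → H →L[ℂ] H := fun n => cfc (fun a : ℝ => ((a - t) / (a + t)) ^ n) A * D *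
          cfc (fun b : ℝ => dyadicBump t b * ((b - t) / (b + t)) ^ n) B with hG
  have hG0 : G 0 = D * cfc (dyadicBump t) B := by
    simp only [hG, pow_zero, mul_one]
    rw [cfc_const_one ℝ A, one_mul]
  have hGlim : Filter.Tendsto G Filter.atTop (nhds 0) := by
    refine squeeze_zero_norm (a := fun n => ‖D‖ * (1 / 3) ^ n) (fun n => ?_) ?_
    · have h1 : ‖cfc (fun a : ℝ => ((a - t) / (a + t)) ^ n) A‖ ≤ 1 := by
        refine norm_cfc_le zero_le_one fun a ha => ?_
        rw [norm_pow]
        exact pow_le_one₀ (norm_nonneg _)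
          (abs_cayley_le_one ht (spectrum_nonneg_of_nonneg hA ha))
      have h2 : ‖cfc (fun b : ℝ => dyadicBump t b * ((b - t) / (b + t)) ^ n) B‖ ≤ (1 / 3) ^ n := by
        refine norm_cfc_le (by positivity) fun b hb => ?_
        rcases dyadicBump_eq_zero_or (b := b) ht with h | ⟨h1, h2⟩
        · rw [h, zero_mul, norm_zero]
          positivity
        · rw [norm_mul, norm_pow, ← one_mul ((1 / 3 : ℝ) ^ n)]
          gcongr
          · exact abs_dyadicBump_le_one t b
          · exact abs_cayley_le_third ht h1 h2
      calc ‖G n‖ ≤ _ :=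
            (norm_mul_le _ _).trans (mul_le_mul_of_nonneg_right (norm_mul_le _ _) (norm_nonneg _))
        _ ≤ 1 * ‖D‖ * (1 / 3) ^ n := by gcongr
        _ = _ := by rw [one_mul]
    · simpa using (tendsto_pow_atTop_nhds_zero_of_lt_one (r := (1 / 3 : ℝ)) (by norm_num)
        (by norm_num)).const_mul ‖D‖
  have hpart : ∀ N, ∑ n ∈ Finset.range N, leftFactor A t n * K * rightFactor B β t n =
      G 0 - G N := fun N => by
    rw [← Finset.sum_range_sub']
    exact Finset.sum_congr rfl fun n _ =>
      leftFactor_mul_mul_rightFactor hA hB (by linarith) ht hD n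
  simp_rw [hpart, ← hG0]
  simpa using hGlim.const_sub (G 0)

/-- The partial sums of the partition of unity converge to the identity only strongly; after
multiplication by `B` they converge in norm. -/
lemma tendsto_sum_cfc_dyadicBump_mul {B : H →L[ℂ] H} (hB : 0 ≤ B) (hB1 : B ≤ 1) :
    Filter.Tendsto (fun J => (∑ j ∈ Finset.range J, cfc (dyadicBump ((1 / 2) ^ j)) B) * B)
      Filter.atTop (nhds B) := by
  have hBsa : IsSelfAdjoint B := .of_nonneg hB
  have hB1' : ∀ x ∈ spectrum ℝ B, x ≤ 1 := (CFC.le_one_iff B).1 hB1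
  rw [tendsto_iff_norm_sub_tendsto_zero]
  refine squeeze_zero (g := fun J : ℕ => 2 * (1 / 2 : ℝ) ^ J) (fun J => norm_nonneg _)
    (fun J => ?_) ?_
  · have h : (∑ j ∈ Finset.range J, cfc (dyadicBump ((1 / 2) ^ j)) B) * B - B =
        cfc (fun b : ℝ => (∑ j ∈ Finset.range J, dyadicBump ((1 / 2) ^ j) b) * b - b) B := by
      have hc : Continuous fun b => ∑ j ∈ Finset.range J, dyadicBump ((1 / 2) ^ j) b :=
        continuous_finsetSum _ fun j _ => continuous_dyadicBump _
      have hs : cfc (fun b => ∑ j ∈ Finset.range J, dyadicBump ((1 / 2) ^ j) b) B =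
          ∑ j ∈ Finset.range J, cfc (dyadicBump ((1 / 2) ^ j)) B := by
        have := cfc_sum (fun j : ℕ => dyadicBump ((1 / 2) ^ j)) B (Finset.range J)
          fun j _ => (continuous_dyadicBump _).continuousOn
        rw [← this]
        congr 1
        ext b
        simp
      rw [cfc_sub (fun b => (∑ j ∈ Finset.range J, dyadicBump ((1 / 2) ^ j) b) * b) (fun b => b) B
          (hc.continuousOn.mul continuousOn_id), cfc_mul _ (fun b => b) B hc.continuousOn, cfc_id' ℝ B, hs]
    rw [h]
    refine norm_cfc_le (by positivity) fun b hb => ?_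
    have hb0 : 0 ≤ b := spectrum_nonneg_of_nonneg hB hb
    rw [sum_dyadicBump J (hB1' b hb), Real.norm_eq_abs,
      show (1 - dyadicCutoff (b / (1 / 2) ^ J)) * b - b = -(dyadicCutoff (b / (1 / 2) ^ J) * b) by
        ring, abs_neg, abs_of_nonneg (mul_nonneg (dyadicCutoff_nonneg _) hb0)]
    have hJ : (0 : ℝ) < (1 / 2) ^ J := by positivity
    rcases le_total 2 (b / (1 / 2) ^ J) with h2 | h2
    · rw [dyadicCutoff_of_two_le h2, zero_mul]
      positivity
    · rw [div_le_iff₀ hJ] at h2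
      exact (mul_le_of_le_one_left hb0 (dyadicCutoff_le_one _)).trans h2
  · simpa using (tendsto_pow_atTop_nhds_zero_of_lt_one (r := (1 / 2 : ℝ)) (by norm_num)
        (by norm_num)).const_mul 2

/-- An injective self-adjoint operator has dense range. -/
lemma eq_of_mul_eq_mul_of_isSelfAdjoint {B S T : H →L[ℂ] H} (hB : IsSelfAdjoint B)
    (hker : (B : H →ₗ[ℂ] H).ker = ⊥) (h : S * B = T * B) : S = T := by
  have hdense : DenseRange B := by
    have h1 : B.rangeᗮ = ⊥ := by
      rw [ContinuousLinearMap.orthogonal_range, hB.adjoint_eq]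
      exact hker
    have h2 := (Submodule.topologicalClosure_eq_top_iff (K := B.range)).2 h1
    have h3 := Submodule.dense_iff_topologicalClosure_eq_top.2 h2
    rwa [LinearMap.coe_range] at h3
  refine ContinuousLinearMap.coeFn_injective (hdense.equalizer S.continuous T.continuous ?_)
  ext x
  exact congrArg (fun F : H →L[ℂ] H => F x) h

lemma norm_leftFactor_mul_mul_rightFactor_le {A B K : H →L[ℂ] H} (hA : 0 ≤ A) (hB : 0 ≤ B) {β : ℝ}
    (hβ : 1 < β) (j n : ℕ) :
    ‖leftFactor A ((1 / 2) ^ j) n * K * rightFactor B β ((1 / 2) ^ j) n‖ ≤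
      ‖K‖ * 2 ^ β * (((1 / 2) ^ (β - 1)) ^ j * (1 / 3) ^ n) := by
  have hw := norm_leftFactor_mul_norm_rightFactor_le hA hB hβ j n
  generalize leftFactor A ((1 / 2) ^ j) n = L at hw ⊢
  generalize rightFactor B β ((1 / 2) ^ j) n = R at hw ⊢
  calc ‖L * K * R‖ ≤ ‖L‖ * ‖K‖ * ‖R‖ :=
        (norm_mul_le _ _).trans (mul_le_mul_of_nonneg_right (norm_mul_le _ _) (norm_nonneg _))
    _ = ‖K‖ * (‖L‖ * ‖R‖) := by ring
    _ ≤ ‖K‖ * (2 ^ β * (((1 / 2) ^ (β - 1)) ^ j * (1 / 3) ^ n)) :=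
        mul_le_mul_of_nonneg_left hw (norm_nonneg _)
    _ = _ := (mul_assoc _ _ _).symm

lemma summable_leftFactor_mul_mul_rightFactor {A B K : H →L[ℂ] H} (hA : 0 ≤ A) (hB : 0 ≤ B)
    {β : ℝ} (hβ : 1 < β) :
    Summable fun i : ℕ × ℕ =>
      leftFactor A ((1 / 2) ^ i.1) i.2 * K * rightFactor B β ((1 / 2) ^ i.1) i.2 := by
  have ha : (1 / 2 : ℝ) ^ (β - 1) < 1 :=
    Real.rpow_lt_one (by norm_num) (by norm_num) (by linarith)
  have hg : Summable fun i : ℕ × ℕ => ((1 / 2 : ℝ) ^ (β - 1)) ^ i.1 * (1 / 3 : ℝ) ^ i.2 :=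
    (summable_geometric_of_lt_one (by positivity) ha).mul_of_nonneg
      (summable_geometric_of_lt_one (by norm_num) (by norm_num))
      (fun n => by positivity) (fun n => by positivity)
  exact Summable.of_norm_bounded (hg.mul_left (‖K‖ * 2 ^ β)) fun i =>
    norm_leftFactor_mul_mul_rightFactor_le hA hB hβ i.1 i.2

/-- Summation by rows, for a family given in curried form. -/
lemma HasSum.of_uncurry {E : Type*} [NormedAddCommGroup E] {F : ℕ → ℕ → E} {g : ℕ → E} {S : E}
    (hS : HasSum (fun i : ℕ × ℕ => F i.1 i.2) S) (hF : ∀ j, HasSum (F j) (g j)) : HasSum g S :=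
  hS.prod_fiberwise hF

lemma hasSum_leftFactor_mul_mul_rightFactor_prod {A B D K : H →L[ℂ] H} (hA : 0 ≤ A) (hB : 0 ≤ B)
    (hB1 : B ≤ 1) (hker : (B : H →ₗ[ℂ] H).ker = ⊥) {β : ℝ} (hβ : 1 < β)
    (hD : A * D + D * B = K * B ^ β) :
    HasSum (fun i : ℕ × ℕ =>
      leftFactor A ((1 / 2) ^ i.1) i.2 * K * rightFactor B β ((1 / 2) ^ i.1) i.2) D := by
  obtain ⟨S, hS⟩ := summable_leftFactor_mul_mul_rightFactor (K := K) hA hB hβ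
  have hcol : HasSum (fun j : ℕ => D * cfc (dyadicBump ((1 / 2) ^ j)) B) S :=
    HasSum.of_uncurry (F := fun j n =>
      leftFactor A ((1 / 2) ^ j) n * K * rightFactor B β ((1 / 2) ^ j) n) hS fun j =>
      hasSum_leftFactor_mul_mul_rightFactor hA hB hβ (by positivity) hD
  have hlim1 := hcol.tendsto_sum_nat.mul_const B
  have hlim2 := (tendsto_sum_cfc_dyadicBump_mul hB hB1).const_mul D
  have heq : S = D := by
    refine eq_of_mul_eq_mul_of_isSelfAdjoint (.of_nonneg hB) hker
      (tendsto_nhds_unique hlim1 (hlim2.congr fun J => ?_))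
    rw [← mul_assoc, Finset.mul_sum]
  rwa [heq] at hS

/-- Every bounded solution `D` of `A D + D B = K B ^ β` with `β > 1` inherits the class `S_p`
from `K`. -/
theorem mem_schattenClass_of_sylvester {A B D K : H →L[ℂ] H} (hA : 0 ≤ A) (hB : 0 ≤ B)
    (hB1 : B ≤ 1) (hker : (B : H →ₗ[ℂ] H).ker = ⊥) {β p : ℝ} (hβ : 1 < β) (hp : 0 < p)
    (hK : K ∈ schattenClass H p) (hD : A * D + D * B = K * B ^ β) : D ∈ schattenClass H p := by
  have ha : (1 / 2 : ℝ≥0) ^ (β - 1) < 1 := NNReal.rpow_lt_one (by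
    rw [← NNReal.coe_lt_coe]; norm_num) (by linarith)
  have hb : (1 / 3 : ℝ≥0) < 1 := by rw [← NNReal.coe_lt_coe]; norm_num
  refine mem_schattenClass_of_hasSum_prod (L := fun i => leftFactor A ((1 / 2) ^ i.1) i.2)
    (R := fun i => rightFactor B β ((1 / 2) ^ i.1) i.2) (C := 2 ^ β) ha hb hp hK
    (hasSum_leftFactor_mul_mul_rightFactor_prod hA hB hB1 hker hβ hD) fun i => ?_
  push_cast
  exact norm_leftFactor_mul_norm_rightFactor_le hA hB hβ i.1 i.2

/-! ### Fractional powers and their unbounded inverses -/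

lemma ker_rpow_eq_bot {X : H →L[ℂ] H} (hX : 0 ≤ X) (hker : (X : H →ₗ[ℂ] H).ker = ⊥) {a : ℝ}
    (ha0 : 0 < a) (ha1 : a ≤ 1) : ((X ^ a : H →L[ℂ] H) : H →ₗ[ℂ] H).ker = ⊥ := by
  have hXsa : IsSelfAdjoint X := .of_nonneg hX
  have hmul : X ^ (1 - a) * X ^ a = X := by
    have hc1 : ContinuousOn (fun x : ℝ => x ^ (1 - a)) (spectrum ℝ X) :=
      (Real.continuous_rpow_const (by linarith)).continuousOn
    have hc2 : ContinuousOn (fun x : ℝ => x ^ a) (spectrum ℝ X) :=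
      (Real.continuous_rpow_const ha0.le).continuousOn
    rw [CFC.rpow_eq_cfc_real hX, CFC.rpow_eq_cfc_real hX, ← cfc_mul _ _ X hc1 hc2]
    conv_rhs => rw [← cfc_id' ℝ X]
    refine cfc_congr fun x hx => ?_
    rw [← Real.rpow_add_of_nonneg (spectrum_nonneg_of_nonneg hX hx) (by linarith) ha0.le,
      sub_add_cancel, Real.rpow_one]
  rw [LinearMap.ker_eq_bot'] at hker ⊢
  intro x hx
  refine hker x ?_
  have h : (X ^ (1 - a)) ((X ^ a) x) = X x := congrArg (fun F : H →L[ℂ] H => F x) hmul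
  rw [ContinuousLinearMap.coe_coe] at hx ⊢
  rw [← h, hx, map_zero]

/-- As `X ^ a` is injective, an extension `K` of `Z X ^ (-a)` satisfies `Z = K X ^ a` everywhere. -/
lemma ExtendsToSchatten.exists_eq_mul_rpow {X Z : H →L[ℂ] H} {a p : ℝ}
    (hker : ((X ^ a : H →L[ℂ] H) : H →ₗ[ℂ] H).ker = ⊥)
    (h : ExtendsToSchatten ((Z : H →ₗ[ℂ] H).compPMap (negPow X a)) p) :
    ∃ K ∈ schattenClass H p, Z = K * X ^ a := by
  obtain ⟨K, hK, hle⟩ := h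
  refine ⟨K, hK, ?_⟩
  ext x
  set S := ((X ^ a : H →L[ℂ] H) : H →ₗ[ℂ] H).toPMap ⊤ with hS
  have hSker : S.toFun.ker = ⊥ := by
    rw [LinearMap.ker_eq_bot'] at hker ⊢
    intro y hy
    exact Subtype.ext (hker y hy)
  have hmem : (X ^ a) x ∈ (negPow X a).domain := by
    rw [negPow, LinearPMap.inverse_domain]
    exact ⟨⟨x, trivial⟩, rfl⟩
  have hinv : negPow X a ⟨(X ^ a) x, hmem⟩ = x :=
    LinearPMap.inverse_apply_eq hSker (y := ⟨(X ^ a) x, hmem⟩) (x := ⟨x, trivial⟩) rfl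
  have h2 := hle.2 (x := ⟨(X ^ a) x, hmem⟩) (y := ⟨(X ^ a) x, trivial⟩) rfl
  have h3 : Z (negPow X a ⟨(X ^ a) x, hmem⟩) = K ((X ^ a) x) := h2
  rwa [hinv] at h3

end Sylvester

theorem lemma2p3 {H : Type*} [NormedAddCommGroup H] [InnerProductSpace ℂ H] [CompleteSpace H]
    (p : ℝ) (hp : 0 < p) (α : ℝ) (hα : α ∈ Set.Ioc (1 / 2 : ℝ) 1)
    (X Y : H →L[ℂ] H) (hX0 : 0 ≤ X) (hX1 : X ≤ 1) (hY0 : 0 ≤ Y) (hY1 : Y ≤ 1)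
    (hker : (X : H →ₗ[ℂ] H).ker = ⊥)
    (hYX : Y - X ∈ schattenClass H p)
    (hext : ExtendsToSchatten (((Y - X : H →L[ℂ] H) : H →ₗ[ℂ] H).compPMap (negPow X α)) p) :
    Y ^ (1 / 2 : ℝ) - X ^ (1 / 2 : ℝ) ∈ schattenClass H p := by
  obtain ⟨hα0, hα1⟩ := hα
  obtain ⟨K, hK, hKX⟩ :=
    hext.exists_eq_mul_rpow (ker_rpow_eq_bot hX0 hker (by linarith) hα1)
  have hsq : ∀ Z : H →L[ℂ] H, 0 ≤ Z → Z ^ (1 / 2 : ℝ) * Z ^ (1 / 2 : ℝ) = Z := fun Z hZ => by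
    rw [← CFC.sqrt_eq_rpow, CFC.sqrt_mul_sqrt_self Z hZ]
  have hle : X ^ (1 / 2 : ℝ) ≤ 1 := by
    rw [CFC.rpow_eq_cfc_real hX0]
    have hXsa : IsSelfAdjoint X := .of_nonneg hX0
    exact cfc_le_one _ X fun x hx => Real.rpow_le_one (spectrum_nonneg_of_nonneg hX0 hx)
      ((CFC.le_one_iff X).1 hX1 x hx) (by norm_num)
  have hpow : (X ^ (1 / 2 : ℝ)) ^ (2 * α) = X ^ α := by
    rw [CFC.rpow_rpow_of_exponent_nonneg X _ _ (by norm_num) (by linarith) hX0]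
    congr 1
    ring
  refine mem_schattenClass_of_sylvester (A := Y ^ (1 / 2 : ℝ)) (B := X ^ (1 / 2 : ℝ)) (β := 2 * α)
    CFC.rpow_nonneg CFC.rpow_nonneg hle
    (ker_rpow_eq_bot hX0 hker (by norm_num) (by norm_num)) (by linarith) hp hK ?_
  rw [hpow, ← hKX, mul_sub, sub_mul, hsq Y hY0, hsq X hX0]
  abel
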